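/- Let $(\Omega,\mathcal A,\mathbb P)$ be a probability space and let $\xi_1,\xi_2,\dots$ be i.i.d. random vectors in $\mathbb R^d$ with law $\mu$. Let $S$ be a nonempty VC class of Borel sets in $\mathbb R^d$, i.e. for some $n$ no sample of $n$ points is shattered by $S$. For $x=(x_1,\dots,x_\ell)$ let $\nu_A(x)=\frac1\ell\#\{i\le\ell: x_i\in A\}$, put $$\pi^{(\ell)}(x)=\sup_{A\in S}|\nu_A(x)-\mu(A)|,\qquad \rho^{(\ell)}(x,y)=\sup_{A\in S}|\nu_A(x)-\nu_A(y)|\quad(x,y\in(\mathbb R^d)^\ell),$$ and suppose that $\pi^{(\ell)}$ and $\rho^{(\ell)}$ are measurable with respect to the completions of $\mu^{\otimes\ell}$ and $\mu^{\otimes 2\ell}$ for all $\ell$. Write also $\pi^{(\ell)}$ for the random variable $\pi^{(\ell)}(\xi_1,\dots,\xi_\ell)$. Let the growth function $m^S(\ell)$ be the maximum over $x_1,\dots,x_\ell\in\mathbb R^d$ of the number of distinct sets $\{i\le\ell: x_i\in A\}$, $A\in S$, and suppose that for some $p>0$ we have $m^S(\ell)\le\ell^p+1$ for all $\ell\in\mathbb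 N=\{1,2,\dots\}$. Then $$\pi^{(\ell)}\longrightarrow 0\quad\text{a.s. as }\ell\to\infty .$$ Moreover, for all $\varepsilon,\delta>0$, with $\mathcal O_\varepsilon=\sum_{\ell=1}^\infty\mathbf 1\{\pi^{(\ell)}>\varepsilon\}$ (a random variable with values in $\{0,1,\dots,\infty\}$) and $$\Lambda_{\varepsilon,\delta}(N)=\sum_{\ell=1}^{N}\frac{e^{\varepsilon^2\ell/8}}{\ell^{1+\delta}\,m^S(2\ell)},\qquad N\in\{0,1,\dots,\infty\},$$ we have $\mathbb E[\Lambda_{\varepsilon,\delta}(\mathcal O_\varepsilon)]<\infty$, and there is a constant $C>0$ such that $$\mathbb P(\mathcal O_\varepsilon\ge k)\le \frac{C}{\Lambda_{\varepsilon,\delta}(k)}\qquad\text{for all }k\in\mathbb N .$$ -/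

import Mathlib

open MeasureTheory ProbabilityTheory Filter Topology
open scoped ENNReal

noncomputable section

namespace VCDeviation

variable {X : Type*}

/-- The relative frequency of the event `A` in the sample `x₁, …, x_ℓ`. -/
def relFreq {ℓ : ℕ} (x : Fin ℓ → X) (A : Set X) : ℝ :=
  (∑ i, A.indicator (fun _ => (1 : ℝ)) (x i)) / ℓ

/-- The maximal deviation over the class `S` of the relative frequency from the probability,
`π^(ℓ)(x₁, …, x_ℓ) = sup_{A ∈ S} |ν_A(x₁, …, x_ℓ) - μ(A)|`.
For a probability measure `μ` all these numbers lie in `[0, 1]`, so that the supremum is genuine. -/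
def maxDev [MeasurableSpace X] (μ : Measure X) (S : Set (Set X)) {ℓ : ℕ} (x : Fin ℓ → X) : ℝ :=
  ⨆ A : S, |relFreq x (A : Set X) - μ.real (A : Set X)|

/-- The maximal difference over the class `S` of the relative frequencies in two samples of the
same size, `ρ^(ℓ)(x, y) = sup_{A ∈ S} |ν_A(x) - ν_A(y)|`. -/
def maxDiff (S : Set (Set X)) {ℓ : ℕ} (z : (Fin ℓ → X) × (Fin ℓ → X)) : ℝ :=
  ⨆ A : S, |relFreq z.1 (A : Set X) - relFreq z.2 (A : Set X)|

/-- The number of different subsamples of the sample `x₁, …, x_r` that are cut out by the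
elements of `S`. -/
def traceCount (S : Set (Set X)) {r : ℕ} (x : Fin r → X) : ℕ :=
  ((fun A : Set X => {i : Fin r | x i ∈ A}) '' S).ncard

/-- The growth function `m^S(r)`: the maximum, over all samples of size `r`, of the number of
subsamples cut out by `S` (a maximum of numbers that are at most `2 ^ r`). -/
def growth (S : Set (Set X)) (r : ℕ) : ℕ :=
  ⨆ x : Fin r → X, traceCount S x

/-- `S` is a VC class: for some `n`, no sample of size `n` is shattered by `S`. -/
def IsVCClass (S : Set (Set X)) : Prop :=
  ∃ n : ℕ, growth S n < 2 ^ n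

/-- The overlap count `O_ε = ∑_{ℓ ≥ 1} 1{π^(ℓ) > ε} ∈ {0, 1, …, ∞}` of a sequence of
observations `ξ 0, ξ 1, …`, where `π^(ℓ)` is evaluated at the first `ℓ` observations. -/
def overlap [MeasurableSpace X] (μ : Measure X) (S : Set (Set X)) (ε : ℝ) (ξ : ℕ → X) : ℕ∞ :=
  {ℓ : ℕ | 1 ≤ ℓ ∧ ε < maxDev μ S (fun i : Fin ℓ => ξ i)}.encard

/-- `Λ_{ε,δ}(N) = ∑_{ℓ = 1}^{N} e^{ε² ℓ / 8} / (ℓ^{1+δ} m^S(2ℓ))`, a finite sum for finite `N`;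
`Λ_{ε,δ}(∞)` is the sum of the whole series. -/
def Lam (S : Set (Set X)) (ε δ : ℝ) (N : ℕ∞) : ℝ≥0∞ :=
  ∑' ℓ : ℕ, if 1 ≤ ℓ ∧ (ℓ : ℕ∞) ≤ N then
    ENNReal.ofReal
      (Real.exp (ε ^ 2 * (ℓ : ℝ) / 8) / ((ℓ : ℝ) ^ (1 + δ) * (growth S (2 * ℓ) : ℝ)))
  else 0

end VCDeviation

end

/-!
The core is the Vapnik–Chervonenkis inequality
`P(π^(ℓ) > ε) ≤ 4 m(2ℓ) exp(-ε² ℓ / 8)` (`measure_lt_maxDev_le`). Symmetrization with an independent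
second sample (`measure_lt_maxDev_le_two_mul`, by Chebyshev's inequality) replaces `π^(ℓ) > ε` by
`ρ^(ℓ) > ε / 2`. The law of the two samples is invariant under exchanging their `i`-th entries for
any set of indices `i`. With the `2ℓ` observations held fixed, only `m(2ℓ)` traces of `S` matter, and
for each of them the proportion of exchanges with a large difference is at most
`2 exp(-ε² ℓ / 8)` by Chernoff's bound for Rademacher sums (`card_lt_maxDiff_swapAt_le`).

The bounds are summable because the growth function is polynomially bounded, so the almost sure
convergence follows from the Borel–Cantelli lemma. If there are at least `k` exceedances, one of them
occurs at an index `≥ k`. Since the growth function is submultiplicative (`growth_add_le`), the sum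
of the bounds over the indices `≥ k` is at most a constant times the bound at `k`
(`measure_le_overlap_le`), whence `P(O ≥ k) ≤ K m(2k) exp(-ε² k / 8)`. The weights of `Λ` are, up to
the factor `k ^ -(1 + δ)`, the inverses of these bounds, so `E[Λ(O)] = ∑ w_k P(O ≥ k)` is dominated
by a multiple of `∑ k ^ -(1 + δ)` (`lintegral_Lam_lt_top`). The final estimate is Markov's inequality
for `Λ(O)`.
-/

namespace VCDeviation

variable {X : Type*}

/-! ### The growth function -/

lemma traceCount_le_two_pow (S : Set (Set X)) {r : ℕ} (x : Fin r → X) :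
    traceCount S x ≤ 2 ^ r := by
  refine (Set.ncard_le_ncard (Set.subset_univ _)).trans_eq ?_
  rw [Set.ncard_univ, Nat.card_eq_fintype_card, Fintype.card_set, Fintype.card_fin]

lemma growth_le_two_pow [Nonempty X] (S : Set (Set X)) (r : ℕ) : growth S r ≤ 2 ^ r :=
  ciSup_le fun x => traceCount_le_two_pow S x

lemma traceCount_le_growth (S : Set (Set X)) {r : ℕ} (x : Fin r → X) :
    traceCount S x ≤ growth S r :=
  le_ciSup (f := fun x : Fin r → X => traceCount S x)
    ⟨2 ^ r, by rintro _ ⟨x, rfl⟩; exact traceCount_le_two_pow S x⟩ x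

lemma growth_pos [Nonempty X] {S : Set (Set X)} (hS : S.Nonempty) (r : ℕ) : 0 < growth S r := by
  obtain ⟨a⟩ := ‹Nonempty X›
  refine lt_of_lt_of_le ?_ (traceCount_le_growth S fun _ : Fin r => a)
  exact (Set.ncard_pos (Set.toFinite _)).2 (hS.image _)

/-- The growth function is submultiplicative, because the trace of a set on a concatenated sample
is determined by its traces on the two parts. -/
lemma growth_add_le [Nonempty X] (S : Set (Set X)) (r s : ℕ) :
    growth S (r + s) ≤ growth S r * growth S s := by
  refine ciSup_le fun x => ?_
  refine le_trans ?_ (Nat.mul_le_mul (traceCount_le_growth S fun i => x (Fin.castAdd s i))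
    (traceCount_le_growth S fun i => x (Fin.natAdd r i)))
  unfold traceCount
  rw [← Set.ncard_prod]
  refine Set.ncard_le_ncard_of_injOn
    (fun B => (Fin.castAdd s ⁻¹' B, Fin.natAdd r ⁻¹' B)) ?_ ?_ (Set.toFinite _)
  · rintro _ ⟨A, hA, rfl⟩
    exact ⟨⟨A, hA, rfl⟩, ⟨A, hA, rfl⟩⟩
  · intro B _ B' _ h
    ext i
    refine Fin.addCases (fun j => ?_) (fun j => ?_) i
    · exact Set.ext_iff.1 (congrArg Prod.fst h) j
    · exact Set.ext_iff.1 (congrArg Prod.snd h) j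

/-! ### Exchanging observations between two samples -/

/-- The Rademacher sign encoded by a Boolean; `true` stands for an exchange, that is, for `-1`. -/
def boolSign (b : Bool) : ℝ := if b then -1 else 1

/-- Chernoff's bound for Rademacher sums: averaged over all signs, `exp (t ∑ ± aᵢ)` is
`∏ cosh (t aᵢ) ≤ exp (ℓ t² / 2)`. -/
lemma card_lt_signed_sum_le {ℓ : ℕ} (a : Fin ℓ → ℝ) (ha : ∀ i, |a i| ≤ 1) {t : ℝ} (ht : 0 ≤ t) :
    (Finset.card {σ : Fin ℓ → Bool | ℓ * t < ∑ i, boolSign (σ i) * a i} : ℝ) ≤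
      2 ^ ℓ * Real.exp (-(ℓ * t ^ 2 / 2)) := by
  have hsum : ∑ σ : Fin ℓ → Bool, Real.exp (t * ∑ i, boolSign (σ i) * a i) ≤
      2 ^ ℓ * Real.exp (ℓ * t ^ 2 / 2) := by
    have h1 : ∑ σ : Fin ℓ → Bool, Real.exp (t * ∑ i, boolSign (σ i) * a i) =
        ∏ i, ∑ b : Bool, Real.exp (t * (boolSign b * a i)) := by
      rw [Finset.prod_univ_sum, Fintype.piFinset_univ]
      exact Finset.sum_congr rfl fun σ _ => by rw [Finset.mul_sum, Real.exp_sum]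
    have h2 : ∀ i, ∑ b : Bool, Real.exp (t * (boolSign b * a i)) ≤ 2 * Real.exp (t ^ 2 / 2) := by
      intro i
      have h3 : ∑ b : Bool, Real.exp (t * (boolSign b * a i)) = 2 * Real.cosh (t * a i) := by
        rw [Real.cosh_eq]
        simp [boolSign]
        ring
      rw [h3]
      have h4 : (t * a i) ^ 2 ≤ t ^ 2 := by
        rw [mul_pow]
        exact mul_le_of_le_one_right (sq_nonneg t) ((sq_le_one_iff_abs_le_one _).2 (ha i))
      gcongr
      exact (Real.cosh_le_exp_half_sq _).trans (Real.exp_le_exp.2 (by linarith))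
    rw [h1]
    refine (Finset.prod_le_prod (fun i _ => Finset.sum_nonneg fun b _ => (Real.exp_pos _).le)
      fun i _ => h2 i).trans_eq ?_
    rw [Finset.prod_const, mul_pow, ← Real.exp_nat_mul, Finset.card_univ, Fintype.card_fin]
    ring_nf
  have hle : (Finset.card {σ : Fin ℓ → Bool | ℓ * t < ∑ i, boolSign (σ i) * a i} : ℝ) *
      Real.exp (t * (ℓ * t)) ≤ 2 ^ ℓ * Real.exp (ℓ * t ^ 2 / 2) := by
    refine le_trans ?_ hsum
    rw [← nsmul_eq_mul]
    refine (Finset.card_nsmul_le_sum _ (fun σ : Fin ℓ → Bool =>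
      Real.exp (t * ∑ i, boolSign (σ i) * a i)) _ fun σ hσ => ?_).trans
      (Finset.sum_le_univ_sum_of_nonneg fun σ => (Real.exp_pos _).le)
    exact Real.exp_le_exp.2 (mul_le_mul_of_nonneg_left (Finset.mem_filter.1 hσ).2.le ht)
  rw [← le_div_iff₀ (Real.exp_pos _), mul_div_assoc, ← Real.exp_sub] at hle
  refine hle.trans_eq ?_
  ring_nf

lemma card_lt_abs_signed_sum_le {ℓ : ℕ} (a : Fin ℓ → ℝ) (ha : ∀ i, |a i| ≤ 1) {t : ℝ}
    (ht : 0 ≤ t) :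
    (Finset.card {σ : Fin ℓ → Bool | ℓ * t < |∑ i, boolSign (σ i) * a i|} : ℝ) ≤
      2 * (2 ^ ℓ * Real.exp (-(ℓ * t ^ 2 / 2))) := by
  have h1 := card_lt_signed_sum_le a ha ht
  have h2 := card_lt_signed_sum_le (fun i => -a i) (fun i => by rw [abs_neg]; exact ha i) ht
  have h3 : Finset.card {σ : Fin ℓ → Bool | ℓ * t < |∑ i, boolSign (σ i) * a i|} ≤
      Finset.card {σ : Fin ℓ → Bool | ℓ * t < ∑ i, boolSign (σ i) * a i} +
      Finset.card {σ : Fin ℓ → Bool | ℓ * t < ∑ i, boolSign (σ i) * -a i} := by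
    classical
    refine (Finset.card_le_card fun σ hσ => ?_).trans (Finset.card_union_le _ _)
    simpa [lt_abs] using hσ
  have h4 : (Finset.card {σ : Fin ℓ → Bool | ℓ * t < |∑ i, boolSign (σ i) * a i|} : ℝ) ≤
      Finset.card {σ : Fin ℓ → Bool | ℓ * t < ∑ i, boolSign (σ i) * a i} +
      Finset.card {σ : Fin ℓ → Bool | ℓ * t < ∑ i, boolSign (σ i) * -a i} := by exact_mod_cast h3
  linarith

/-- Exchange of the `i`-th observations of the two samples for all `i` with `σ i = true`. -/
def swapAt {ℓ : ℕ} (σ : Fin ℓ → Bool) (z : (Fin ℓ → X) × (Fin ℓ → X)) :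
    (Fin ℓ → X) × (Fin ℓ → X) :=
  (fun i => if σ i then z.2 i else z.1 i, fun i => if σ i then z.1 i else z.2 i)

lemma relFreq_swapAt_sub {ℓ : ℕ} (σ : Fin ℓ → Bool) (z : (Fin ℓ → X) × (Fin ℓ → X)) (A : Set X) :
    relFreq (swapAt σ z).1 A - relFreq (swapAt σ z).2 A =
      (∑ i, boolSign (σ i) * (A.indicator (fun _ => (1 : ℝ)) (z.1 i) -
        A.indicator (fun _ => (1 : ℝ)) (z.2 i))) / ℓ := by
  unfold relFreq swapAt boolSign
  rw [← sub_div, ← Finset.sum_sub_distrib]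
  congr 1
  refine Finset.sum_congr rfl fun i _ => ?_
  cases hi : σ i <;> simp [hi]

/-- The union bound: however many sets `S` has, only as many exchange problems have to be
controlled as there are traces of `S` on the `2ℓ` observations. -/
lemma card_lt_maxDiff_swapAt_le {S : Set (Set X)} (hS : S.Nonempty) {ℓ : ℕ}
    (z : (Fin ℓ → X) × (Fin ℓ → X)) {t : ℝ} (ht : 0 ≤ t) :
    (Finset.card {σ : Fin ℓ → Bool | t < maxDiff S (swapAt σ z)} : ℝ) ≤
      growth S (2 * ℓ) * (2 * (2 ^ ℓ * Real.exp (-(ℓ * t ^ 2 / 2)))) := by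
  classical
  have : Nonempty S := hS.to_subtype
  let x : Fin (ℓ + ℓ) → X := Fin.append z.1 z.2
  let T : Finset (Set (Fin (ℓ + ℓ))) :=
    (Set.toFinite ((fun A : Set X => {i | x i ∈ A}) '' S)).toFinset
  have hT : T.card ≤ growth S (2 * ℓ) := by
    rw [two_mul]
    refine le_trans (le_of_eq ?_) (traceCount_le_growth S x)
    exact (Set.ncard_eq_toFinset_card _ _).symm
  -- On the trace of `A`, `a` takes the values `1_A(xᵢ) - 1_A(yᵢ)`.
  let a (B : Set (Fin (ℓ + ℓ))) (i : Fin ℓ) : ℝ :=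
    B.indicator (fun _ => (1 : ℝ)) (Fin.castAdd ℓ i) -
      B.indicator (fun _ => (1 : ℝ)) (Fin.natAdd ℓ i)
  have ha : ∀ B i, |a B i| ≤ 1 := by
    intro B i
    simp only [a, Set.indicator_apply]
    split_ifs <;> norm_num
  have hsub : ({σ : Fin ℓ → Bool | t < maxDiff S (swapAt σ z)} : Finset _) ⊆
      T.biUnion fun B => {σ : Fin ℓ → Bool | ℓ * t < |∑ i, boolSign (σ i) * a B i|} := by
    intro σ hσ
    obtain ⟨⟨A, hA⟩, hlt⟩ := exists_lt_of_lt_ciSup (Finset.mem_filter.1 hσ).2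
    refine Finset.mem_biUnion.2 ⟨{i | x i ∈ A}, ?_, ?_⟩
    · exact (Set.Finite.mem_toFinset _).2 ⟨A, hA, rfl⟩
    · refine Finset.mem_filter.2 ⟨Finset.mem_univ _, ?_⟩
      rw [relFreq_swapAt_sub, abs_div, Nat.abs_cast] at hlt
      -- For `ℓ = 0` the quotient in `hlt` is `0`, which contradicts `0 ≤ t`.
      have hℓ : (0 : ℝ) < ℓ := by
        rcases Nat.eq_zero_or_pos ℓ with rfl | h
        · simp at hlt; linarith
        · exact_mod_cast h
      rw [lt_div_iff₀ hℓ, mul_comm] at hlt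
      have heq : ∀ i, a {i | x i ∈ A} i = A.indicator (fun _ => (1 : ℝ)) (z.1 i) -
          A.indicator (fun _ => (1 : ℝ)) (z.2 i) := by
        intro i
        simp only [a, x, Set.indicator_apply, Set.mem_ofPred_eq, Fin.append_left, Fin.append_right]
      simpa only [heq] using hlt
  have hcard : (Finset.card {σ : Fin ℓ → Bool | t < maxDiff S (swapAt σ z)} : ℝ) ≤
      ∑ B ∈ T, (Finset.card {σ : Fin ℓ → Bool | ℓ * t < |∑ i, boolSign (σ i) * a B i|} : ℝ) := by
    exact_mod_cast (Finset.card_le_card hsub).trans Finset.card_biUnion_le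
  refine hcard.trans ((Finset.sum_le_card_nsmul _ _ _ fun B _ =>
    card_lt_abs_signed_sum_le (a B) (ha B) ht).trans ?_)
  rw [nsmul_eq_mul]
  gcongr

/-! ### The Vapnik–Chervonenkis inequality -/

lemma indicator_one_mem_Icc (A : Set X) (a : X) :
    A.indicator (fun _ => (1 : ℝ)) a ∈ Set.Icc (0 : ℝ) 1 := by
  by_cases h : a ∈ A <;> simp [h]

lemma lt_maxDiff_of_lt {S : Set (Set X)} {ℓ : ℕ} (z : (Fin ℓ → X) × (Fin ℓ → X)) {A : Set X}
    (hA : A ∈ S) {t : ℝ} (h : t < |relFreq z.1 A - relFreq z.2 A|) : t < maxDiff S z := by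
  have hfreq (x : Fin ℓ → X) (A : Set X) : relFreq x A ∈ Set.Icc (0 : ℝ) 1 := by
    have h0 (i : Fin ℓ) := indicator_one_mem_Icc A (x i)
    refine ⟨div_nonneg (Finset.sum_nonneg fun i _ => (h0 i).1) (Nat.cast_nonneg _), ?_⟩
    refine div_le_one_of_le₀ ?_ (Nat.cast_nonneg _)
    refine (Finset.sum_le_card_nsmul _ _ 1 fun i _ => (h0 i).2).trans_eq ?_
    simp
  refine h.trans_le (le_ciSup (f := fun A : S => |relFreq z.1 (A : Set X) - relFreq z.2 A|)
    ⟨1, ?_⟩ ⟨A, hA⟩)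
  rintro _ ⟨A, rfl⟩
  have h1 := hfreq z.1 A
  have h2 := hfreq z.2 A
  exact abs_le.2 ⟨by linarith [h1.1, h2.2], by linarith [h1.2, h2.1]⟩

section Inequality

variable [MeasurableSpace X]

lemma measurePreserving_swapAt (μ : Measure X) [IsProbabilityMeasure μ] {ℓ : ℕ}
    (σ : Fin ℓ → Bool) :
    MeasurePreserving (swapAt σ)
      ((Measure.pi fun _ : Fin ℓ => μ).prod (Measure.pi fun _ : Fin ℓ => μ))
      ((Measure.pi fun _ : Fin ℓ => μ).prod (Measure.pi fun _ : Fin ℓ => μ)) := by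
  have h1 := measurePreserving_arrowProdEquivProdArrow X X (Fin ℓ) (fun _ => μ) (fun _ => μ)
  have h2 : MeasurePreserving
      (fun (z : Fin ℓ → X × X) i => (if σ i then Prod.swap else id) (z i))
      (Measure.pi fun _ => μ.prod μ) (Measure.pi fun _ => μ.prod μ) := by
    refine measurePreserving_pi _ _ (f := fun i => if σ i then Prod.swap else id) fun i => ?_
    split_ifs
    · exact Measure.measurePreserving_swap
    · exact MeasurePreserving.id _
  convert! (h1.comp h2).comp h1.symm using 1
  ext z i <;>
  · simp only [swapAt, Function.comp, MeasurableEquiv.arrowProdEquivProdArrow,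
      Equiv.arrowProdEquivProdArrow]
    cases hi : σ i <;> simp [hi]

/-- The deviation between two samples: the probability of `t < maxDiff` does not change under
exchanges, so it is the mean over both samples of the proportion of exchanges that lead to
`t < maxDiff`. -/
lemma measure_lt_maxDiff_le (μ : Measure X) [IsProbabilityMeasure μ] {S : Set (Set X)}
    (hS : S.Nonempty) {ℓ : ℕ}
    (hdiff : AEMeasurable (fun z : (Fin ℓ → X) × (Fin ℓ → X) => maxDiff S z)
      ((Measure.pi fun _ => μ).prod (Measure.pi fun _ => μ))) {t : ℝ} (ht : 0 ≤ t) :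
    ((Measure.pi fun _ => μ).prod (Measure.pi fun _ => μ))
        {z : (Fin ℓ → X) × (Fin ℓ → X) | t < maxDiff S z} ≤
      ENNReal.ofReal (2 * growth S (2 * ℓ) * Real.exp (-(ℓ * t ^ 2 / 2))) := by
  classical
  set ν := (Measure.pi fun _ : Fin ℓ => μ).prod (Measure.pi fun _ : Fin ℓ => μ)
  set B := {z : (Fin ℓ → X) × (Fin ℓ → X) | t < maxDiff S z}
  have hB : NullMeasurableSet B ν := nullMeasurableSet_lt aemeasurable_const hdiff
  have hpre (σ : Fin ℓ → Bool) : NullMeasurableSet (swapAt σ ⁻¹' B) ν :=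
    hB.preimage (measurePreserving_swapAt μ σ).quasiMeasurePreserving
  have h1 : (2 : ℝ≥0∞) ^ ℓ * ν B =
      ∫⁻ z, ∑ σ : Fin ℓ → Bool, (swapAt σ ⁻¹' B).indicator 1 z ∂ν := by
    rw [lintegral_finsetSum' _ (f := fun σ => (swapAt σ ⁻¹' B).indicator 1) fun σ _ =>
      aemeasurable_one.indicator₀ (hpre σ)]
    rw [Finset.sum_congr rfl fun σ _ => by
      rw [lintegral_indicator_one₀ (hpre σ), (measurePreserving_swapAt μ σ).measure_preimage hB]]
    rw [Finset.sum_const, Finset.card_univ, nsmul_eq_mul]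
    simp [ν]
  have h2 : (2 : ℝ≥0∞) ^ ℓ * ν B ≤
      2 ^ ℓ * ENNReal.ofReal (2 * growth S (2 * ℓ) * Real.exp (-(ℓ * t ^ 2 / 2))) := by
    have h3 : (2 : ℝ≥0∞) ^ ℓ = ENNReal.ofReal (2 ^ ℓ) := by
      rw [ENNReal.ofReal_pow (by norm_num), ENNReal.ofReal_ofNat]
    rw [h1, h3, ← ENNReal.ofReal_mul (by positivity)]
    refine (lintegral_mono fun z => ?_).trans_eq ((lintegral_const _).trans (by
      rw [measure_univ, mul_one]))
    have h4 : ∑ σ : Fin ℓ → Bool,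
        (swapAt σ ⁻¹' B).indicator (1 : (Fin ℓ → X) × (Fin ℓ → X) → ℝ≥0∞) z =
        (Finset.card {σ : Fin ℓ → Bool | t < maxDiff S (swapAt σ z)} : ℝ≥0∞) := by
      rw [Finset.card_filter, Nat.cast_sum]
      refine Finset.sum_congr rfl fun σ _ => ?_
      simp [Set.indicator_apply, B]
    rw [h4, ← ENNReal.ofReal_natCast]
    refine ENNReal.ofReal_le_ofReal ((card_lt_maxDiff_swapAt_le hS z ht).trans_eq ?_)
    ring
  exact (ENNReal.mul_le_mul_iff_right (by positivity) (by finiteness)).1 h2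

/-- Chebyshev's inequality for the sample mean of a `[0, 1]`-valued function, whose variance is at
most `1 / 4`. -/
lemma measure_lt_abs_sampleMean_sub_le (μ : Measure X) [IsProbabilityMeasure μ] {f : X → ℝ}
    (hf : Measurable f) (hf01 : ∀ a, f a ∈ Set.Icc (0 : ℝ) 1) {ℓ : ℕ} (hℓ : 1 ≤ ℓ) {t : ℝ}
    (ht : 0 < t) :
    (Measure.pi fun _ : Fin ℓ => μ) {y | t < |(∑ i, f (y i)) / ℓ - ∫ a, f a ∂μ|} ≤
      ENNReal.ofReal (1 / (4 * ℓ * t ^ 2)) := by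
  set ν := Measure.pi fun _ : Fin ℓ => μ
  have hℓ' : (0 : ℝ) < ℓ := by exact_mod_cast hℓ
  have hY (i : Fin ℓ) : Measurable fun y : Fin ℓ → X => f (y i) :=
    hf.comp (measurable_pi_apply i)
  have hmem (i : Fin ℓ) : MemLp (fun y : Fin ℓ → X => f (y i)) 2 ν :=
    MemLp.of_bound (hY i).aestronglyMeasurable 1 (Eventually.of_forall fun y => by
      rw [Real.norm_eq_abs, abs_le]
      exact ⟨by linarith [(hf01 (y i)).1], (hf01 (y i)).2⟩)
  have hint (i : Fin ℓ) : ∫ y, f (y i) ∂ν = ∫ a, f a ∂μ := by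
    have h := measurePreserving_eval (fun _ : Fin ℓ => μ) i
    rw [← h.map_eq, integral_map h.measurable.aemeasurable hf.aestronglyMeasurable]
  have hindep : iIndepFun (fun i (y : Fin ℓ → X) => f (y i)) ν :=
    iIndepFun_pi (X := fun _ : Fin ℓ => f) fun i => hf.aemeasurable
  have hvar : variance (∑ i, fun y : Fin ℓ → X => f (y i)) ν ≤ ℓ / 4 := by
    rw [IndepFun.variance_sum (X := fun i (y : Fin ℓ → X) => f (y i)) (fun i _ => hmem i)
      fun i _ j _ hij => hindep.indepFun hij]
    have h1 (i : Fin ℓ) : variance (fun y : Fin ℓ → X => f (y i)) ν ≤ 1 / 4 := by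
      have h2 := variance_le_sq_of_bounded (μ := ν) (X := fun y : Fin ℓ → X => f (y i))
        (Eventually.of_forall fun y => hf01 (y i)) (hY i).aemeasurable
      linarith
    have h2 := Finset.sum_le_sum fun i (_ : i ∈ Finset.univ) => h1 i
    rw [Finset.sum_const, Finset.card_univ, Fintype.card_fin, nsmul_eq_mul] at h2
    linarith
  have hmean : ∫ y, (∑ i, fun y : Fin ℓ → X => f (y i)) y ∂ν = ℓ * ∫ a, f a ∂μ := by
    simp only [Finset.sum_apply]
    rw [integral_finsetSum _ fun i _ => (hmem i).integrable (by norm_num)]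
    simp [hint]
  have hcheb := meas_ge_le_variance_div_sq (μ := ν)
    (memLp_finsetSum' (f := fun i (y : Fin ℓ → X) => f (y i)) Finset.univ fun i _ => hmem i)
    (c := ℓ * t) (by positivity)
  refine (measure_mono fun y hy => ?_).trans (hcheb.trans (ENNReal.ofReal_le_ofReal ?_))
  · have hy' : t < |(∑ i, f (y i)) / ℓ - ∫ a, f a ∂μ| := hy
    rw [Set.mem_ofPred_eq, hmean, Finset.sum_apply]
    have h : (∑ i, f (y i)) - ℓ * ∫ a, f a ∂μ = ℓ * ((∑ i, f (y i)) / ℓ - ∫ a, f a ∂μ) := by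
      field_simp
    rw [h, abs_mul, Nat.abs_cast]
    exact mul_le_mul_of_nonneg_left hy'.le hℓ'.le
  · refine (div_le_div_of_nonneg_right hvar (by positivity)).trans_eq ?_
    field_simp

lemma measure_lt_abs_relFreq_sub_le (μ : Measure X) [IsProbabilityMeasure μ] {A : Set X}
    (hA : MeasurableSet A) {ℓ : ℕ} (hℓ : 1 ≤ ℓ) {t : ℝ} (ht : 0 < t) :
    (Measure.pi fun _ : Fin ℓ => μ) {y | t < |relFreq y A - μ.real A|} ≤
      ENNReal.ofReal (1 / (4 * ℓ * t ^ 2)) := by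
  have h := measure_lt_abs_sampleMean_sub_le μ (measurable_const.indicator hA)
    (indicator_one_mem_Icc A) hℓ ht
  rwa [integral_indicator_const _ hA, smul_eq_mul, mul_one] at h

/-- Symmetrization: a second, independent sample has with probability at least `1 / 2` a relative
frequency close to the probability of an event on which the first sample deviates by more than
`2 t`, and then the two samples differ by more than `t`. -/
lemma measure_lt_maxDev_le_two_mul (μ : Measure X) [IsProbabilityMeasure μ] {S : Set (Set X)}
    (hS : S.Nonempty) (hS_meas : ∀ A ∈ S, MeasurableSet A) {ℓ : ℕ} (hℓ : 1 ≤ ℓ) {t : ℝ}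
    (ht : 0 < t) (hℓt : 1 ≤ 2 * ℓ * t ^ 2) :
    (Measure.pi fun _ : Fin ℓ => μ) {x | 2 * t < maxDev μ S x} ≤
      2 * ((Measure.pi fun _ => μ).prod (Measure.pi fun _ => μ))
        {z : (Fin ℓ → X) × (Fin ℓ → X) | t < maxDiff S z} := by
  have : Nonempty S := hS.to_subtype
  set ν := Measure.pi fun _ : Fin ℓ => μ
  set B := {z : (Fin ℓ → X) × (Fin ℓ → X) | t < maxDiff S z}
  -- Fubini's theorem is applied to a measurable superset, so that no measurability is needed here.
  set T := toMeasurable (ν.prod ν) B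
  have hT : MeasurableSet T := measurableSet_toMeasurable _ _
  have hsub : {x : Fin ℓ → X | 2 * t < maxDev μ S x} ⊆
      {x | (2 : ℝ≥0∞)⁻¹ ≤ ν (Prod.mk x ⁻¹' T)} := by
    intro x hx
    obtain ⟨⟨A, hA⟩, hlt⟩ := exists_lt_of_lt_ciSup (Set.mem_ofPred_eq ▸ hx)
    have hcompl : {y : Fin ℓ → X | t < |relFreq y A - μ.real A|}ᶜ ⊆ Prod.mk x ⁻¹' T := by
      intro y hy
      rw [Set.mem_compl_iff, Set.mem_ofPred_eq, not_lt] at hy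
      refine subset_toMeasurable _ _ (lt_maxDiff_of_lt (x, y) hA ?_)
      have h := abs_sub_le (relFreq x A) (relFreq y A) (μ.real A)
      simp only at hlt ⊢
      linarith
    have hcheb : ν {y : Fin ℓ → X | t < |relFreq y A - μ.real A|} ≤ 2⁻¹ := by
      refine (measure_lt_abs_relFreq_sub_le μ (hS_meas A hA) hℓ ht).trans ?_
      rw [← ENNReal.ofReal_ofNat, ← ENNReal.ofReal_inv_of_pos (by norm_num)]
      refine ENNReal.ofReal_le_ofReal ?_
      rw [one_div]
      exact inv_anti₀ (by norm_num) (by linarith)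
    have hone : 1 ≤ ν {y : Fin ℓ → X | t < |relFreq y A - μ.real A|} +
        ν {y : Fin ℓ → X | t < |relFreq y A - μ.real A|}ᶜ := by
      rw [← measure_univ (μ := ν), ← Set.union_compl_self
        {y : Fin ℓ → X | t < |relFreq y A - μ.real A|}]
      exact measure_union_le _ _
    refine le_trans ?_ (measure_mono hcompl)
    rw [← ENNReal.one_sub_inv_two, tsub_le_iff_left]
    exact hone.trans (add_le_add_left hcheb _)
  have hmarkov := mul_meas_ge_le_lintegral (μ := ν) (measurable_measure_prodMk_left (ν := ν) hT)
    (2 : ℝ≥0∞)⁻¹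
  rw [← Measure.prod_apply hT, measure_toMeasurable, ENNReal.inv_mul_le_iff (by simp) (by simp)]
    at hmarkov
  exact (measure_mono hsub).trans hmarkov

/-- The Vapnik–Chervonenkis inequality. For `ℓ ε² < 2`, where symmetrization is not available, the
right-hand side exceeds `1`. -/
lemma measure_lt_maxDev_le (μ : Measure X) [IsProbabilityMeasure μ] {S : Set (Set X)}
    (hS : S.Nonempty) (hS_meas : ∀ A ∈ S, MeasurableSet A) {ℓ : ℕ}
    (hdiff : AEMeasurable (fun z : (Fin ℓ → X) × (Fin ℓ → X) => maxDiff S z)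
      ((Measure.pi fun _ => μ).prod (Measure.pi fun _ => μ))) {ε : ℝ} (hε : 0 < ε) :
    (Measure.pi fun _ : Fin ℓ => μ) {x | ε < maxDev μ S x} ≤
      ENNReal.ofReal (4 * growth S (2 * ℓ) * Real.exp (-(ε ^ 2 / 8 * ℓ))) := by
  have : Nonempty X := (Measure.nonempty_of_neZero μ)
  by_cases h : 2 ≤ ℓ * ε ^ 2
  · have hℓ : 1 ≤ ℓ := by
      by_contra! h0
      obtain rfl : ℓ = 0 := by omega
      norm_num at h
    have h1 := measure_lt_maxDev_le_two_mul μ hS hS_meas hℓ (half_pos hε)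
      (by linarith [show 2 * (ℓ : ℝ) * (ε / 2) ^ 2 = ℓ * ε ^ 2 / 2 by ring])
    rw [mul_div_cancel₀ ε two_ne_zero] at h1
    refine h1.trans ?_
    refine (mul_le_mul_right (measure_lt_maxDiff_le μ hS hdiff (half_pos hε).le) 2).trans_eq ?_
    rw [← ENNReal.ofReal_ofNat, ← ENNReal.ofReal_mul (by norm_num)]
    ring_nf
  · refine prob_le_one.trans ?_
    rw [ENNReal.one_le_ofReal]
    have h1 : (1 : ℝ) ≤ growth S (2 * ℓ) := by exact_mod_cast growth_pos hS (2 * ℓ)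
    have h2 : (3 / 4 : ℝ) ≤ Real.exp (-(ε ^ 2 / 8 * ℓ)) := by
      linarith [Real.add_one_le_exp (-(ε ^ 2 / 8 * ℓ))]
    nlinarith

end Inequality

/-! ### The sequence of bounds -/

/-- The right-hand side of the Vapnik–Chervonenkis inequality, without its constant factor; there
`c = ε ^ 2 / 8`. -/
noncomputable def vcBound (S : Set (Set X)) (c : ℝ) (ℓ : ℕ) : ℝ :=
  growth S (2 * ℓ) * Real.exp (-(c * ℓ))

lemma vcBound_nonneg (S : Set (Set X)) (c : ℝ) (ℓ : ℕ) : 0 ≤ vcBound S c ℓ := by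
  unfold vcBound
  positivity

lemma vcBound_add_le [Nonempty X] (S : Set (Set X)) (c : ℝ) (k j : ℕ) :
    vcBound S c (k + j) ≤ vcBound S c k * vcBound S c j := by
  have h : (growth S (2 * (k + j)) : ℝ) ≤ growth S (2 * k) * growth S (2 * j) := by
    rw [mul_add]
    exact_mod_cast growth_add_le S (2 * k) (2 * j)
  calc vcBound S c (k + j)
      ≤ growth S (2 * k) * growth S (2 * j) * Real.exp (-(c * (k + j : ℕ))) :=
        mul_le_mul_of_nonneg_right h (Real.exp_pos _).le
    _ = vcBound S c k * vcBound S c j := by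
        rw [Nat.cast_add, mul_add, neg_add, Real.exp_add]
        unfold vcBound
        ring

lemma summable_vcBound [Nonempty X] {S : Set (Set X)} {p : ℝ}
    (hgrowth : ∀ ℓ : ℕ, 1 ≤ ℓ → (growth S ℓ : ℝ) ≤ (ℓ : ℝ) ^ p + 1) {c : ℝ} (hc : 0 < c) :
    Summable (vcBound S c) := by
  have hpoly (ℓ : ℕ) : (growth S (2 * ℓ) : ℝ) ≤ 2 ^ ⌈p⌉₊ * (ℓ : ℝ) ^ ⌈p⌉₊ + 1 := by
    rcases Nat.eq_zero_or_pos ℓ with rfl | hℓ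
    · have h : (growth S (2 * 0) : ℝ) ≤ 1 := by exact_mod_cast growth_le_two_pow S 0
      exact h.trans (le_add_of_nonneg_left (by positivity))
    · refine (hgrowth (2 * ℓ) (by omega)).trans ?_
      rw [← mul_pow, ← Real.rpow_natCast]
      have h1 : (1 : ℝ) ≤ (2 * ℓ : ℕ) := by exact_mod_cast (by omega : 1 ≤ 2 * ℓ)
      have h2 := Real.rpow_le_rpow_of_exponent_le h1 (Nat.le_ceil p)
      push_cast at h2 ⊢
      linarith
  have h0 := Real.summable_pow_mul_exp_neg_nat_mul 0 hc
  have h1 := Real.summable_pow_mul_exp_neg_nat_mul ⌈p⌉₊ hc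
  refine Summable.of_nonneg_of_le (vcBound_nonneg S c) (fun ℓ => ?_)
    ((h1.mul_left (2 ^ ⌈p⌉₊)).add h0)
  refine (mul_le_mul_of_nonneg_right (hpoly ℓ) (Real.exp_pos _).le).trans_eq ?_
  rw [neg_mul]
  ring

/-! ### The series `Λ` and the overlap count -/

lemma Lam_mono (S : Set (Set X)) (ε δ : ℝ) : Monotone (Lam S ε δ) := by
  intro M N hMN
  refine ENNReal.tsum_le_tsum fun ℓ => ?_
  split_ifs with h1 h2
  · rfl
  · exact absurd ⟨h1.1, h1.2.trans hMN⟩ h2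
  · exact zero_le
  · rfl

lemma Lam_natCast_ne_top (S : Set (Set X)) (ε δ : ℝ) (k : ℕ) : Lam S ε δ k ≠ ⊤ := by
  unfold Lam
  rw [tsum_eq_sum (s := Finset.range (k + 1))]
  · refine ENNReal.sum_ne_top.2 fun ℓ _ => ?_
    split_ifs <;> finiteness
  · intro ℓ hℓ
    refine if_neg fun h => hℓ (Finset.mem_range.2 ?_)
    have : ℓ ≤ k := by exact_mod_cast h.2
    omega

lemma Lam_natCast_ne_zero [Nonempty X] {S : Set (Set X)} (hS : S.Nonempty) (ε δ : ℝ) {k : ℕ}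
    (hk : 1 ≤ k) : Lam S ε δ k ≠ 0 := by
  have hg : (0 : ℝ) < growth S (2 * 1) := by exact_mod_cast growth_pos hS _
  refine (lt_of_lt_of_le ?_ (ENNReal.le_tsum 1)).ne'
  rw [if_pos ⟨le_rfl, by exact_mod_cast hk⟩, ENNReal.ofReal_pos]
  simp only [Nat.cast_one, Real.one_rpow]
  positivity

/-- If at least `k` of the positive integers belong to a set, one of them is at least `k`. -/
lemma exists_ge_of_le_encard {s : Set ℕ} (hs : ∀ ℓ ∈ s, 1 ≤ ℓ) {k : ℕ} (hk : 1 ≤ k)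
    (h : (k : ℕ∞) ≤ s.encard) : ∃ ℓ ∈ s, k ≤ ℓ := by
  by_contra! hlt
  have hsub : s ⊆ (Finset.Ico 1 k : Finset ℕ) := fun ℓ hℓ => by
    simpa using ⟨hs ℓ hℓ, hlt ℓ hℓ⟩
  have h1 := h.trans (Set.encard_le_encard hsub)
  rw [Set.encard_coe_eq_coe_finsetCard, Nat.card_Ico] at h1
  have : k ≤ k - 1 := by exact_mod_cast h1
  omega

lemma aemeasurable_encard_setOf_mem {Ω : Type*} [MeasurableSpace Ω] {P : Measure Ω}
    {E : ℕ → Set Ω} (hE : ∀ ℓ, NullMeasurableSet (E ℓ) P) :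
    AEMeasurable (fun ω => {ℓ | ω ∈ E ℓ}.encard) P := by
  choose F _ hF hFE using fun ℓ => (hE ℓ).exists_measurable_superset_ae_eq
  refine ⟨fun ω => {ℓ | ω ∈ F ℓ}.encard,
    measurable_encard.comp (measurable_set_iff.2 fun ℓ => (hF ℓ).mem), ?_⟩
  filter_upwards [ae_all_iff.2 fun ℓ => (hFE ℓ).mem_iff] with ω hω
  simp only [hω]

/-- `E[Λ(O)] = ∑ w_ℓ P(O ≥ ℓ)` for the weights `w_ℓ` of `Λ`, and these are chosen such that the
bound on `P(O ≥ ℓ)` leaves a multiple of `∑ 1 / ℓ ^ (1 + δ)`. -/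
lemma lintegral_Lam_lt_top [Nonempty X] {Ω : Type*} [MeasurableSpace Ω]
    {P : Measure Ω} {S : Set (Set X)} (hS : S.Nonempty) {ε δ K : ℝ} (hδ : 0 < δ)
    {O : Ω → ℕ∞} (hO : AEMeasurable O P)
    (htail : ∀ k : ℕ, 1 ≤ k → P {ω | (k : ℕ∞) ≤ O ω} ≤
      ENNReal.ofReal (K * vcBound S (ε ^ 2 / 8) k)) :
    ∫⁻ ω, Lam S ε δ (O ω) ∂P < ⊤ := by
  let w (ℓ : ℕ) : ℝ :=
    Real.exp (ε ^ 2 * (ℓ : ℝ) / 8) / ((ℓ : ℝ) ^ (1 + δ) * (growth S (2 * ℓ) : ℝ))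
  have hw0 (ℓ : ℕ) : 0 ≤ w ℓ := by positivity
  have hw (ℓ : ℕ) : w ℓ * (K * vcBound S (ε ^ 2 / 8) ℓ) = K * (1 / (ℓ : ℝ) ^ (1 + δ)) := by
    have hg : (growth S (2 * ℓ) : ℝ) ≠ 0 := by exact_mod_cast (growth_pos hS _).ne'
    have he : Real.exp (ε ^ 2 * (ℓ : ℝ) / 8) * Real.exp (-(ε ^ 2 / 8 * ℓ)) = 1 := by
      rw [← Real.exp_add, ← Real.exp_zero]
      ring_nf
    calc w ℓ * (K * vcBound S (ε ^ 2 / 8) ℓ)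
        = (Real.exp (ε ^ 2 * (ℓ : ℝ) / 8) * Real.exp (-(ε ^ 2 / 8 * ℓ))) * K *
            ((growth S (2 * ℓ) : ℝ) / growth S (2 * ℓ)) * (1 / (ℓ : ℝ) ^ (1 + δ)) := by
          simp only [w, vcBound]
          ring
      _ = K * (1 / (ℓ : ℝ) ^ (1 + δ)) := by rw [he, div_self hg]; ring
  have hmeas (ℓ : ℕ) : NullMeasurableSet {ω | 1 ≤ ℓ ∧ (ℓ : ℕ∞) ≤ O ω} P :=
    hO.nullMeasurable (Set.to_countable {N : ℕ∞ | 1 ≤ ℓ ∧ (ℓ : ℕ∞) ≤ N}).measurableSet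
  have hterm (ℓ : ℕ) : (fun ω => if 1 ≤ ℓ ∧ (ℓ : ℕ∞) ≤ O ω then ENNReal.ofReal (w ℓ) else 0) =
      {ω | 1 ≤ ℓ ∧ (ℓ : ℕ∞) ≤ O ω}.indicator fun _ => ENNReal.ofReal (w ℓ) := by
    classical
    ext ω
    simp only [Set.indicator_apply, Set.mem_ofPred_eq]
  have hle (ℓ : ℕ) : ENNReal.ofReal (w ℓ) * P {ω | 1 ≤ ℓ ∧ (ℓ : ℕ∞) ≤ O ω} ≤
      ENNReal.ofReal (K * (1 / (ℓ : ℝ) ^ (1 + δ))) := by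
    rcases Nat.eq_zero_or_pos ℓ with rfl | hℓ
    · simp
    · rw [← hw, ENNReal.ofReal_mul (hw0 ℓ)]
      exact mul_le_mul_right ((measure_mono fun ω h => h.2).trans (htail ℓ hℓ)) _
  have hsum : Summable fun ℓ : ℕ => K * (1 / (ℓ : ℝ) ^ (1 + δ)) :=
    (Real.summable_one_div_nat_rpow.2 (by linarith)).mul_left K
  calc ∫⁻ ω, Lam S ε δ (O ω) ∂P
      = ∑' ℓ : ℕ, ∫⁻ ω, {ω | 1 ≤ ℓ ∧ (ℓ : ℕ∞) ≤ O ω}.indicator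
          (fun _ => ENNReal.ofReal (w ℓ)) ω ∂P := by
        rw [← lintegral_tsum fun ℓ => aemeasurable_const.indicator₀ (hmeas ℓ)]
        refine lintegral_congr fun ω => tsum_congr fun ℓ => ?_
        exact congrFun (hterm ℓ) ω
    _ = ∑' ℓ : ℕ, ENNReal.ofReal (w ℓ) * P {ω | 1 ≤ ℓ ∧ (ℓ : ℕ∞) ≤ O ω} :=
        tsum_congr fun ℓ => lintegral_indicator_const₀ (hmeas ℓ) _
    _ ≤ ∑' ℓ : ℕ, ENNReal.ofReal (K * (1 / (ℓ : ℝ) ^ (1 + δ))) := ENNReal.tsum_le_tsum hle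
    _ < ⊤ := hsum.tsum_ofReal_lt_top

lemma measure_le_le_div_Lam [Nonempty X] {Ω : Type*} [MeasurableSpace Ω]
    {P : Measure Ω} {S : Set (Set X)} (hS : S.Nonempty) {ε δ : ℝ} {O : Ω → ℕ∞}
    (hO : AEMeasurable O P) (hfin : ∫⁻ ω, Lam S ε δ (O ω) ∂P < ⊤) :
    ∃ C : ℝ, 0 < C ∧ ∀ k : ℕ, 1 ≤ k →
      P {ω | (k : ℕ∞) ≤ O ω} ≤ ENNReal.ofReal C / Lam S ε δ (k : ℕ∞) := by
  -- the summand `1` only makes the constant positive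
  refine ⟨(∫⁻ ω, Lam S ε δ (O ω) ∂P).toReal + 1, by positivity, fun k hk => ?_⟩
  have hsub : {ω | (k : ℕ∞) ≤ O ω} ⊆ {ω | Lam S ε δ k ≤ Lam S ε δ (O ω)} :=
    fun ω hω => Lam_mono S ε δ hω
  refine (measure_mono hsub).trans ((meas_ge_le_lintegral_div
    ((measurable_of_countable (Lam S ε δ)).comp_aemeasurable hO) (Lam_natCast_ne_zero hS ε δ hk)
    (Lam_natCast_ne_top S ε δ k)).trans (ENNReal.div_le_div_right ?_ _))
  exact (ENNReal.ofReal_toReal hfin.ne).symm.le.trans (ENNReal.ofReal_le_ofReal (by linarith))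

/-! ### Sequences of observations -/

section Sequence

variable [MeasurableSpace X] {Ω : Type*} [MeasurableSpace Ω] {P : Measure Ω}
  {μ : Measure X} {ξ : ℕ → Ω → X}
  {S : Set (Set X)}

lemma measurePreserving_sample [IsProbabilityMeasure P] (hξ_meas : ∀ i, Measurable (ξ i))
    (hξ_indep : iIndepFun ξ P) (hξ_law : ∀ i, P.map (ξ i) = μ) (ℓ : ℕ) :
    MeasurePreserving (fun ω (i : Fin ℓ) => ξ i ω) P (Measure.pi fun _ => μ) := by
  refine ⟨measurable_pi_lambda _ fun i => hξ_meas i, ?_⟩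
  have h := (iIndepFun_iff_map_fun_eq_pi_map (f := fun i : Fin ℓ => ξ i)
    fun i => (hξ_meas i).aemeasurable).1 (hξ_indep.precomp Fin.val_injective)
  simpa only [hξ_law] using h

/-- Borel–Cantelli along the thresholds `1 / (n + 1)`. -/
lemma ae_tendsto_maxDev
    (hsum : ∀ ε : ℝ, 0 < ε →
      ∑' ℓ : ℕ, P {ω | ε < maxDev μ S fun i : Fin ℓ => ξ i ω} ≠ ⊤) :
    ∀ᵐ ω ∂P, Tendsto (fun ℓ : ℕ => maxDev μ S fun i : Fin ℓ => ξ i ω) atTop (𝓝 0) := by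
  have h : ∀ᵐ ω ∂P, ∀ n : ℕ, ∀ᶠ ℓ : ℕ in atTop,
      ¬ 1 / ((n : ℝ) + 1) < maxDev μ S fun i : Fin ℓ => ξ i ω :=
    ae_all_iff.2 fun n => ae_eventually_notMem (hsum _ Nat.one_div_pos_of_nat)
  filter_upwards [h] with ω hω
  refine Metric.tendsto_atTop'.2 fun e he => ?_
  obtain ⟨n, hn⟩ := exists_nat_one_div_lt he
  obtain ⟨L, hL⟩ := eventually_atTop.1 (hω n)
  refine ⟨L, fun ℓ hℓ => ?_⟩
  have h0 : 0 ≤ maxDev μ S fun i : Fin ℓ => ξ i ω := Real.iSup_nonneg fun A => abs_nonneg _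
  rw [Real.dist_eq, sub_zero, abs_of_nonneg h0]
  exact (not_lt.1 (hL ℓ hℓ.le)).trans_lt hn

/-- At least `k` exceedances force one at some index `k + j`; submultiplicativity turns the sum of
the corresponding bounds into a multiple of the bound at `k`. -/
lemma measure_le_overlap_le [Nonempty X] {ε c K : ℝ} (hK : 0 ≤ K)
    (hP : ∀ ℓ : ℕ, P {ω | ε < maxDev μ S fun i : Fin ℓ => ξ i ω} ≤
      ENNReal.ofReal (K * vcBound S c ℓ)) (hsum : Summable (vcBound S c)) {k : ℕ} (hk : 1 ≤ k) :
    P {ω | (k : ℕ∞) ≤ overlap μ S ε fun i => ξ i ω} ≤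
      ENNReal.ofReal (K * (∑' j, vcBound S c j) * vcBound S c k) := by
  have hsub : {ω | (k : ℕ∞) ≤ overlap μ S ε fun i => ξ i ω} ⊆
      ⋃ j : ℕ, {ω | ε < maxDev μ S fun i : Fin (k + j) => ξ i ω} := by
    intro ω hω
    obtain ⟨ℓ, hℓ, hkℓ⟩ := exists_ge_of_le_encard (fun ℓ hℓ => hℓ.1) hk hω
    obtain ⟨j, rfl⟩ := Nat.exists_eq_add_of_le hkℓ
    exact Set.mem_iUnion.2 ⟨j, hℓ.2⟩
  have hle (j : ℕ) : P {ω | ε < maxDev μ S fun i : Fin (k + j) => ξ i ω} ≤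
      ENNReal.ofReal (K * vcBound S c k * vcBound S c j) := by
    refine (hP (k + j)).trans (ENNReal.ofReal_le_ofReal ?_)
    rw [mul_assoc]
    exact mul_le_mul_of_nonneg_left (vcBound_add_le S c k j) hK
  refine (measure_mono hsub).trans ((measure_iUnion_le _).trans
    ((ENNReal.tsum_le_tsum hle).trans_eq ?_))
  rw [← ENNReal.ofReal_tsum_of_nonneg
    (fun j => mul_nonneg (mul_nonneg hK (vcBound_nonneg S c k)) (vcBound_nonneg S c j))
    (hsum.mul_left _), tsum_mul_left]
  ring_nf

end Sequence

end VCDeviation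

theorem theorem3 {d : ℕ} {Ω : Type*} [MeasurableSpace Ω] (P : Measure Ω) [IsProbabilityMeasure P]
    -- an i.i.d. sequence of observations with values in `ℝ^d` and common law `μ`
    (μ : Measure (EuclideanSpace ℝ (Fin d))) [IsProbabilityMeasure μ]
    (ξ : ℕ → Ω → EuclideanSpace ℝ (Fin d))
    (hξ_meas : ∀ i, Measurable (ξ i))
    (hξ_indep : iIndepFun ξ P)
    (hξ_law : ∀ i, P.map (ξ i) = μ)
    -- a nonempty VC class of events
    (S : Set (Set (EuclideanSpace ℝ (Fin d)))) (hS_ne : S.Nonempty)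
    (hS_meas : ∀ A ∈ S, MeasurableSet A)
    (hS_vc : VCDeviation.IsVCClass S)
    -- the maximal deviations are random variables on the (completed) sample spaces
    (hdev : ∀ ℓ : ℕ, AEMeasurable
      (fun x : Fin ℓ → EuclideanSpace ℝ (Fin d) => VCDeviation.maxDev μ S x)
      (Measure.pi fun _ => μ))
    (hdiff : ∀ ℓ : ℕ, AEMeasurable
      (fun z : (Fin ℓ → EuclideanSpace ℝ (Fin d)) × (Fin ℓ → EuclideanSpace ℝ (Fin d)) =>
        VCDeviation.maxDiff S z)
      ((Measure.pi fun _ => μ).prod (Measure.pi fun _ => μ)))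
    -- polynomial bound on the growth function
    (p : ℝ) (hp : 0 < p)
    (hgrowth : ∀ ℓ : ℕ, 1 ≤ ℓ → (VCDeviation.growth S ℓ : ℝ) ≤ (ℓ : ℝ) ^ p + 1) :
    (∀ᵐ ω ∂P, Tendsto
      (fun ℓ : ℕ => VCDeviation.maxDev μ S (fun i : Fin ℓ => ξ i ω)) atTop (𝓝 0)) ∧
    ∀ ε : ℝ, 0 < ε →
      AEMeasurable (fun ω => VCDeviation.overlap μ S ε (fun i => ξ i ω)) P ∧
      ∀ δ : ℝ, 0 < δ →
        (∫⁻ ω, VCDeviation.Lam S ε δ (VCDeviation.overlap μ S ε (fun i => ξ i ω)) ∂P) < ⊤ ∧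
        ∃ C : ℝ, 0 < C ∧ ∀ k : ℕ, 1 ≤ k →
          P {ω | (k : ℕ∞) ≤ VCDeviation.overlap μ S ε (fun i => ξ i ω)} ≤
            ENNReal.ofReal C / VCDeviation.Lam S ε δ (k : ℕ∞) := by
  have hsample := VCDeviation.measurePreserving_sample hξ_meas hξ_indep hξ_law
  have hnull (ε : ℝ) (ℓ : ℕ) : NullMeasurableSet
      {x : Fin ℓ → EuclideanSpace ℝ (Fin d) | ε < VCDeviation.maxDev μ S x}
      (Measure.pi fun _ => μ) := nullMeasurableSet_lt aemeasurable_const (hdev ℓ)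
  have hP (ε : ℝ) (hε : 0 < ε) (ℓ : ℕ) :
      P {ω | ε < VCDeviation.maxDev μ S fun i : Fin ℓ => ξ i ω} ≤
        ENNReal.ofReal (4 * VCDeviation.vcBound S (ε ^ 2 / 8) ℓ) := by
    refine ((hsample ℓ).measure_preimage (hnull ε ℓ)).trans_le ?_
    refine (VCDeviation.measure_lt_maxDev_le μ hS_ne hS_meas (hdiff ℓ) hε).trans_eq ?_
    rw [VCDeviation.vcBound, mul_assoc]
  have hsum (ε : ℝ) (hε : 0 < ε) : Summable (VCDeviation.vcBound S (ε ^ 2 / 8)) :=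
    VCDeviation.summable_vcBound hgrowth (by positivity)
  refine ⟨VCDeviation.ae_tendsto_maxDev fun ε hε => ne_top_of_le_ne_top
    ((hsum ε hε).mul_left 4).tsum_ofReal_ne_top (ENNReal.tsum_le_tsum (hP ε hε)),
    fun ε hε => ?_⟩
  have hO : AEMeasurable (fun ω => VCDeviation.overlap μ S ε fun i => ξ i ω) P :=
    VCDeviation.aemeasurable_encard_setOf_mem
      (E := fun ℓ => {ω | 1 ≤ ℓ ∧ ε < VCDeviation.maxDev μ S fun i : Fin ℓ => ξ i ω})
      fun ℓ => (MeasurableSet.const _).nullMeasurableSet.inter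
        ((hnull ε ℓ).preimage (hsample ℓ).quasiMeasurePreserving)
  refine ⟨hO, fun δ hδ => ?_⟩
  have hfin := VCDeviation.lintegral_Lam_lt_top hS_ne (ε := ε) hδ hO
    fun k hk => VCDeviation.measure_le_overlap_le zero_le_four (hP ε hε) (hsum ε hε) hk
  exact ⟨hfin, VCDeviation.measure_le_le_div_Lam hS_ne hO hfin⟩
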